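/- Let $k,\ell\ge 1$ be integers and let $\lambda=(\lambda_1\ge\lambda_2\ge\cdots)$ be a partition in the hook $H(k,\ell)$, i.e. $\lambda_{k+1}\le \ell$. Order the letters as $t_1<\dots<t_k<u_1<\dots<u_\ell$. A $(k,\ell)$-semistandard tableau of shape $\lambda$ is a filling $T$ of the Young diagram of $\lambda$ with these letters whose entries are weakly increasing along rows and down columns, such that the $t$-letters are strictly increasing down columns and the $u$-letters are strictly increasing along rows. Let $a_i(T)$ and $b_j(T)$ be the numbers of occurrences of $t_i$ and $u_j$ in $T$, and let \[ S_\lambda(x,y)=\sum_{T} x_1^{a_1(T)}\cdots x_k^{a_k(T)}\,y_1^{b_1(T)}\cdots y_\ell^{b_\ell(T)}\in\mathbb Z[x_1,\dots,x_k,y_1,\dots,y_\ell], \] the sum being over all $(k,\ell)$-semistandard tableaux $T$ of shape $\lambda$, be the supersymmetric Schur polynomial. Then $S_\lambda$ has a saturated Newton polytope: if $\operatorname{Supp}(S_\lambda)\subset\mathbb Z^{k+\ell}$ is the set of exponent vectors of the monomials with non-zero coefficient in $S_\lambda$ and $\operatorname{Newton}(S_\lambda)\subset\mathbb R^{k+\ell}$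 is the convex hull of $\operatorname{Supp}(S_\lambda)$, then \[ \operatorname{Newton}(S_\lambda)\cap\mathbb Z^{k+\ell}=\operatorname{Supp}(S_\lambda). \] -/

import Mathlib

/-- The partition `μ` lies in the hook `H(k, ℓ)`: its part number `k + 1` is at most `ℓ`.
Partitions are Young diagrams, whose rows are numbered from `0`. -/
def InHook (k ℓ : ℕ) (μ : YoungDiagram) : Prop :=
  μ.rowLen k ≤ ℓ

/-- `T` is a `(k, ℓ)`-semistandard tableau of shape `μ`. The letter `t_i` is `Sum.inl i`, the letter
`u_j` is `Sum.inr j`, and the alphabet carries the total order `t_1 < ⋯ < t_k < u_1 < ⋯ < u_ℓ`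
(the lexicographic order on the sum). A cell is a pair `(row, column)`. -/
structure IsSuperSemistandard {k ℓ : ℕ} {μ : YoungDiagram}
    (T : {c // c ∈ μ.cells} → Fin k ⊕ Fin ℓ) : Prop where
  /-- entries are weakly increasing along rows -/
  row_weak : ∀ c d : {c // c ∈ μ.cells}, c.1.1 = d.1.1 → c.1.2 < d.1.2 →
    toLex (T c) ≤ toLex (T d)
  /-- entries are weakly increasing down columns -/
  col_weak : ∀ c d : {c // c ∈ μ.cells}, c.1.2 = d.1.2 → c.1.1 < d.1.1 →
    toLex (T c) ≤ toLex (T d)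
  /-- the `t`-letters are strictly increasing down columns -/
  t_col_strict : ∀ c d : {c // c ∈ μ.cells}, c.1.2 = d.1.2 → c.1.1 < d.1.1 →
    ∀ i i' : Fin k, T c = Sum.inl i → T d = Sum.inl i' → i < i'
  /-- the `u`-letters are strictly increasing along rows -/
  u_row_strict : ∀ c d : {c // c ∈ μ.cells}, c.1.1 = d.1.1 → c.1.2 < d.1.2 →
    ∀ j j' : Fin ℓ, T c = Sum.inr j → T d = Sum.inr j' → j < j'

/-- The number of occurrences of the letter `s` in the filling `T`. -/
def letterCount {k ℓ : ℕ} {μ : YoungDiagram} (T : {c // c ∈ μ.cells} → Fin k ⊕ Fin ℓ)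
    (s : Fin k ⊕ Fin ℓ) : ℕ :=
  (Finset.univ.filter fun c => T c = s).card

open Classical in
/-- The finite set of `(k, ℓ)`-semistandard tableaux of shape `μ`. -/
noncomputable def superSSYT (k ℓ : ℕ) (μ : YoungDiagram) :
    Finset ({c // c ∈ μ.cells} → Fin k ⊕ Fin ℓ) :=
  Finset.univ.filter fun T => IsSuperSemistandard T

/-- The supersymmetric Schur polynomial `S_μ(x, y)`; the variable `x_i` is `X (Sum.inl i)` and
`y_j` is `X (Sum.inr j)`. -/
noncomputable def superSchur (k ℓ : ℕ) (μ : YoungDiagram) : MvPolynomial (Fin k ⊕ Fin ℓ) ℤ :=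
  ∑ T ∈ superSSYT k ℓ μ,
    (∏ i : Fin k, MvPolynomial.X (Sum.inl i) ^ letterCount T (Sum.inl i)) *
      ∏ j : Fin ℓ, MvPolynomial.X (Sum.inr j) ^ letterCount T (Sum.inr j)

/-- The support of `f`, as a set of points of `ℝ^σ`. -/
def realSupport {σ R : Type*} [CommSemiring R] (f : MvPolynomial σ R) : Set (σ → ℝ) :=
  {p | ∃ α : σ →₀ ℕ, MvPolynomial.coeff α f ≠ 0 ∧ p = fun i => (α i : ℝ)}

/-- The Newton polytope of `f`. -/
def newtonPolytope {σ R : Type*} [CommSemiring R] (f : MvPolynomial σ R) : Set (σ → ℝ) :=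
  convexHull ℝ (realSupport f)

/-- The lattice `ℤ^σ` inside `ℝ^σ`. -/
def latticePoints (σ : Type*) : Set (σ → ℝ) :=
  Set.range fun (z : σ → ℤ) (i : σ) => (z i : ℝ)

/-- `f` has a saturated Newton polytope. -/
def HasSaturatedNewtonPolytope {σ R : Type*} [CommSemiring R] (f : MvPolynomial σ R) : Prop :=
  newtonPolytope f ∩ latticePoints σ = realSupport f

/-! The support is exactly the set of lattice points of `hookPolytope`: non-negative vectors of
total `μ.card` in which any `a` of the `t`-letters and `b` of the `u`-letters have total at most the
number of cells in the first `a` rows or first `b` columns. This set is convex, so it contains the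
Newton polytope, and saturation follows.

Necessity (`IsSuperSemistandard.sum_letterCount_le`): cells carrying the chosen letters are pushed
injectively up or left into the hook.

Sufficiency (`exists_tableau_of_hook_inequalities`): Hall's theorem, in the form of
`exists_capacitated_assignment`, distributes the `u`-letters over rows so that the remaining row
lengths `m`, possibly unsorted, still dominate the content `α`. A second application, in the manner
of Gale–Ryser, distributes the `t`-letters over columns, filling column `c` exactly as often as some
`m r` exceeds `c`. Adding the letters one at a time and sorting the resulting lengths gives a chain
of Young diagrams: horizontal strips for the `t`-letters, then vertical strips for the `u`-letters.
Such a chain is a tableau (`exists_tableau_of_chain`). -/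

/-! ### Integral flows from Hall's theorem -/

/-- Integral flow lemma. Letters of the first kind (`i : ι`, multiplicity `α i`) may be placed in
rows of `A i`, letters of the second kind (`j : κ`, multiplicity `β j`) may be placed in any row,
but at most once in each row; row `r` has capacity `cap r`. -/
theorem exists_capacitated_assignment {R ι κ : Type*} [Fintype R] [DecidableEq R] [Fintype ι]
    [DecidableEq ι] [Fintype κ] [DecidableEq κ] (cap : R → ℕ) (A : ι → Finset R)
    (α : ι → ℕ) (β : κ → ℕ)
    (h : ∀ (I : Finset ι) (J : Finset κ) (Q : Finset R), (∀ i ∈ I, A i ⊆ Q) →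
      ∑ i ∈ I, α i + ∑ j ∈ J, β j ≤ ∑ r ∈ Q, cap r + J.card * Qᶜ.card) :
    ∃ U : κ → Finset R, (∀ j, (U j).card = β j) ∧
      ∀ (I : Finset ι) (Q : Finset R), (∀ i ∈ I, A i ⊆ Q) →
        ∑ i ∈ I, α i + ∑ r ∈ Q, (Finset.univ.filter fun j => r ∈ U j).card ≤ ∑ r ∈ Q, cap r := by
  classical
  -- The flow is encoded as a matching. A token of the second kind must occupy a pair `(j, r)` in
  -- `K`, which forces the copy of `(j, r)` in `L` into a slot of row `r`; an unoccupied pair may be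
  -- matched to itself. Since each pair occurs once in `K`, a letter uses a row at most once.
  let L := ((Σ i : ι, Fin (α i)) ⊕ (Σ j : κ, Fin (β j))) ⊕ (κ × R)
  let K := (Σ r : R, Fin (cap r)) ⊕ (κ × R)
  let rel : L → K → Prop := fun x y => match x, y with
    | .inl (.inl x), .inl y => y.1 ∈ A x.1
    | .inl (.inl _), .inr _ => False
    | .inl (.inr _), .inl _ => False
    | .inl (.inr x), .inr e => e.1 = x.1
    | .inr e, .inl y => y.1 = e.2
    | .inr e, .inr e' => e' = e
  obtain ⟨f, hf, hfr⟩ : ∃ f : L → K, Function.Injective f ∧ ∀ x, rel x (f x) := by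
    rw [← Fintype.all_card_le_filter_rel_iff_exists_injective]
    intro X
    let Xt := X.toLeft.toLeft
    let Xu := X.toLeft.toRight
    let E := X.toRight
    let I := Xt.image Sigma.fst
    let J := Xu.image Sigma.fst
    -- Including the rows of `E` makes `E` disjoint from `J ×ˢ Qᶜ`. Both sets of pairs and all slots
    -- of `Q` are neighbours of `X`, so the hypothesis for `Q` plus `E.card` is Hall's condition.
    let Q : Finset R := I.biUnion A ∪ E.image Prod.snd
    have hX : X.card = Xt.card + Xu.card + E.card := by
      rw [Finset.card_toLeft_add_card_toRight, Finset.card_toLeft_add_card_toRight]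
    have hI : Xt.card ≤ ∑ i ∈ I, α i := by
      calc Xt.card ≤ (I.sigma fun i => (Finset.univ : Finset (Fin (α i)))).card := by
            apply Finset.card_le_card
            intro x hx
            simp only [Finset.mem_sigma, Finset.mem_univ, and_true]
            exact Finset.mem_image_of_mem _ hx
        _ = _ := by simp
    have hJ : Xu.card ≤ ∑ j ∈ J, β j := by
      calc Xu.card ≤ (J.sigma fun i => (Finset.univ : Finset (Fin (β i)))).card := by
            apply Finset.card_le_card
            intro x hx
            simp only [Finset.mem_sigma, Finset.mem_univ, and_true]
            exact Finset.mem_image_of_mem _ hx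
        _ = _ := by simp
    have hQ := h I J Q (fun i hi => (Finset.subset_biUnion_of_mem A hi).trans
      Finset.subset_union_left)
    have hdisj : Disjoint E (J ×ˢ Qᶜ) := by
      rw [Finset.disjoint_left]
      intro e he he'
      have h1 := (Finset.mem_product.1 he').2
      rw [Finset.mem_compl] at h1
      exact h1 (Finset.mem_union_right _ (Finset.mem_image_of_mem _ he))
    have hN : ((Q.sigma fun r => (Finset.univ : Finset (Fin (cap r)))).disjSum
        (E ∪ J ×ˢ Qᶜ)).card = ∑ r ∈ Q, cap r + (E.card + J.card * Qᶜ.card) := by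
      rw [Finset.card_disjSum, Finset.card_union_of_disjoint hdisj, Finset.card_product]
      simp
    have hsub : ((Q.sigma fun r => (Finset.univ : Finset (Fin (cap r)))).disjSum
        (E ∪ J ×ˢ Qᶜ)) ⊆ Finset.univ.filter fun b => ∃ a ∈ X, rel a b := by
      intro y hy
      rw [Finset.mem_filter]
      refine ⟨Finset.mem_univ _, ?_⟩
      rcases y with y | e
      · rw [Finset.inl_mem_disjSum, Finset.mem_sigma] at hy
        rcases Finset.mem_union.1 hy.1 with hy | hy
        · obtain ⟨i, hi, hiA⟩ := Finset.mem_biUnion.1 hy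
          obtain ⟨x, hx, rfl⟩ := Finset.mem_image.1 hi
          exact ⟨_, Finset.mem_toLeft.1 (Finset.mem_toLeft.1 hx), hiA⟩
        · obtain ⟨e, he, hey⟩ := Finset.mem_image.1 hy
          exact ⟨_, Finset.mem_toRight.1 he, hey.symm⟩
      · rw [Finset.inr_mem_disjSum, Finset.mem_union] at hy
        rcases hy with hy | hy
        · exact ⟨_, Finset.mem_toRight.1 hy, rfl⟩
        · obtain ⟨x, hx, hxe⟩ := Finset.mem_image.1 (Finset.mem_product.1 hy).1
          exact ⟨_, Finset.mem_toLeft.1 (Finset.mem_toRight.1 hx), hxe.symm⟩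
    have := Finset.card_le_card hsub
    rw [hN] at this
    refine le_trans ?_ this
    omega
  have hu : ∀ x : Σ j : κ, Fin (β j), ∃ r, f (.inl (.inr x)) = .inr (x.1, r) := by
    intro x
    have := hfr (.inl (.inr x))
    rcases hx : f (.inl (.inr x)) with y | e
    · rw [hx] at this; exact this.elim
    · rw [hx] at this
      have : e.1 = x.1 := this
      exact ⟨e.2, by rw [← this]⟩
  choose g hg using hu
  let U : κ → Finset R := fun j => Finset.univ.image fun x : Fin (β j) => g ⟨j, x⟩
  refine ⟨U, ?_, ?_⟩
  · intro j
    rw [Finset.card_image_of_injective, Finset.card_univ, Fintype.card_fin]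
    intro x y hxy
    have hxy : g ⟨j, x⟩ = g ⟨j, y⟩ := hxy
    have h1 : f (.inl (.inr ⟨j, x⟩)) = f (.inl (.inr ⟨j, y⟩)) := by rw [hg, hg, hxy]
    have h2 := Sum.inr_injective (Sum.inl_injective (hf h1))
    exact eq_of_heq (Sigma.mk.inj h2).2
  · intro I Q hIQ
    have ht : ∀ x : Σ i : ι, Fin (α i), ∃ y, f (.inl (.inl x)) = .inl y ∧ y.1 ∈ A x.1 := by
      intro x
      have := hfr (.inl (.inl x))
      rcases hx : f (.inl (.inl x)) with y | e
      · rw [hx] at this; exact ⟨y, rfl, this⟩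
      · rw [hx] at this; exact this.elim
    -- The pair `(j, r)` in `K` is already taken by a token, so injectivity sends its copy in `L` to
    -- a slot.
    have he : ∀ j r, r ∈ U j → ∃ y, f (.inr (j, r)) = .inl y ∧ y.1 = r := by
      intro j r hr
      obtain ⟨x, -, rfl⟩ := Finset.mem_image.1 hr
      have := hfr (.inr (j, g ⟨j, x⟩))
      rcases hx : f (.inr (j, g ⟨j, x⟩)) with y | e
      · rw [hx] at this; exact ⟨y, rfl, this⟩
      · rw [hx] at this
        have h2 : e = (j, g ⟨j, x⟩) := this
        rw [h2, ← hg ⟨j, x⟩] at hx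
        exact absurd (hf hx) (by simp)
    -- Tokens of `I` and displaced pairs over `Q` all land in slots of `Q`; counting them gives the
    -- residual inequality.
    let S := ((I.sigma fun i => (Finset.univ : Finset (Fin (α i)))).disjSum
      (∅ : Finset (Σ j : κ, Fin (β j)))).disjSum
      ((Finset.univ ×ˢ Q).filter fun e => e.2 ∈ U e.1)
    have hS : S.card = ∑ i ∈ I, α i + ∑ r ∈ Q, (Finset.univ.filter fun j => r ∈ U j).card := by
      simp only [S, Finset.card_disjSum, Finset.card_sigma, Finset.card_univ, Fintype.card_fin,
        Finset.card_empty, add_zero]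
      congr 1
      rw [Finset.card_filter, Finset.sum_product_right]
      simp only [Finset.card_filter]
    have hT : ((Q.sigma fun r => (Finset.univ : Finset (Fin (cap r)))).disjSum
        (∅ : Finset (κ × R))).card = ∑ r ∈ Q, cap r := by simp
    rw [← hS, ← hT]
    refine Finset.card_le_card_of_injOn f ?_ hf.injOn
    intro x hx
    rw [Finset.mem_coe] at hx ⊢
    rcases x with (x | x) | e
    · obtain ⟨y, hy, hyA⟩ := ht x
      rw [hy, Finset.inl_mem_disjSum, Finset.mem_sigma]
      rw [Finset.inl_mem_disjSum, Finset.inl_mem_disjSum, Finset.mem_sigma] at hx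
      exact ⟨hIQ _ hx.1 hyA, Finset.mem_univ _⟩
    · rw [Finset.inl_mem_disjSum, Finset.inr_mem_disjSum] at hx
      exact absurd hx (Finset.notMem_empty _)
    · rw [Finset.inr_mem_disjSum, Finset.mem_filter, Finset.mem_product] at hx
      obtain ⟨y, hy, hyr⟩ := he e.1 e.2 hx.2
      rw [hy, Finset.inl_mem_disjSum, Finset.mem_sigma]
      exact ⟨hyr ▸ hx.1.2, Finset.mem_univ _⟩

/-! ### Shapes obtained by sorting row lengths -/

/-- The Young diagram, as a set of cells in an `n × w` box, whose row lengths are the values of `p`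
sorted in decreasing order. -/
def sortedShape (n w : ℕ) (p : Fin n → ℕ) : Finset (ℕ × ℕ) :=
  (Finset.range n ×ˢ Finset.range w).filter fun x =>
    x.1 < (Finset.univ.filter fun r => x.2 < p r).card

theorem mem_sortedShape {n w : ℕ} {p : Fin n → ℕ} {r c : ℕ} :
    (r, c) ∈ sortedShape n w p ↔ c < w ∧ r < (Finset.univ.filter fun r' => c < p r').card := by
  have h : (Finset.univ.filter fun r' => c < p r').card ≤ n :=
    (Finset.card_le_univ _).trans_eq (Fintype.card_fin n)
  simp only [sortedShape, Finset.mem_filter, Finset.mem_product, Finset.mem_range]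
  constructor
  · rintro ⟨⟨_, h1⟩, h2⟩
    exact ⟨h1, h2⟩
  · rintro ⟨h1, h2⟩
    exact ⟨⟨h2.trans_le h, h1⟩, h2⟩

theorem sum_card_filter_lt {ι : Type*} (s : Finset ι) {w : ℕ} {p : ι → ℕ} (hp : ∀ r, p r ≤ w) :
    ∑ c ∈ Finset.range w, (s.filter fun r => c < p r).card = ∑ r ∈ s, p r := by
  simp only [Finset.card_filter]
  rw [Finset.sum_comm]
  refine Finset.sum_congr rfl fun r _ => ?_
  rw [← Finset.card_filter]
  have : (Finset.range w).filter (fun c => c < p r) = Finset.range (p r) := by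
    ext c
    simp only [Finset.mem_filter, Finset.mem_range]
    have := hp r
    omega
  rw [this, Finset.card_range]

theorem card_sortedShape {n w : ℕ} {p : Fin n → ℕ} (hp : ∀ r, p r ≤ w) :
    (sortedShape n w p).card = ∑ r, p r := by
  rw [← sum_card_filter_lt Finset.univ hp, sortedShape, Finset.card_filter,
    Finset.sum_product_right]
  refine Finset.sum_congr rfl fun c _ => ?_
  rw [← Finset.card_filter]
  have h : (Finset.univ.filter fun r' => c < p r').card ≤ n :=
    (Finset.card_le_univ _).trans_eq (Fintype.card_fin n)
  have : (Finset.range n).filter (fun r => r < (Finset.univ.filter fun r' => c < p r').card) =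
      Finset.range (Finset.univ.filter fun r' => c < p r').card := by
    ext r
    simp only [Finset.mem_filter, Finset.mem_range]
    omega
  rw [this, Finset.card_range]

theorem sortedShape_mono {n w : ℕ} {p p' : Fin n → ℕ} (h : ∀ r, p r ≤ p' r) :
    sortedShape n w p ⊆ sortedShape n w p' := by
  rintro ⟨r, c⟩ hx
  rw [mem_sortedShape] at hx ⊢
  refine ⟨hx.1, hx.2.trans_le (Finset.card_le_card ?_)⟩
  intro r' hr'
  simp only [Finset.mem_filter, Finset.mem_univ, true_and] at hr' ⊢
  exact hr'.trans_le (h r')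

theorem sortedShape_lower {n w : ℕ} {p : Fin n → ℕ} {r c r' c' : ℕ} (hr : r' ≤ r) (hc : c' ≤ c)
    (h : (r, c) ∈ sortedShape n w p) : (r', c') ∈ sortedShape n w p := by
  rw [mem_sortedShape] at h ⊢
  refine ⟨hc.trans_lt h.1, (hr.trans_lt h.2).trans_le (Finset.card_le_card ?_)⟩
  intro s hs
  simp only [Finset.mem_filter, Finset.mem_univ, true_and] at hs ⊢
  exact hc.trans_lt hs

/-- Column `c` has height the number of entries above `c`. Raising each entry by at most one makes
the new column `c + 1` no taller than the old column `c`, so each sorted row also grows by at most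
one cell. -/
theorem sortedShape_strip {n w : ℕ} {p p' : Fin n → ℕ} (hp : ∀ r, p' r ≤ p r + 1) {r c : ℕ}
    (h : (r, c + 1) ∈ sortedShape n w p') : (r, c) ∈ sortedShape n w p := by
  rw [mem_sortedShape] at h ⊢
  refine ⟨by omega, h.2.trans_le (Finset.card_le_card ?_)⟩
  intro s hs
  simp only [Finset.mem_filter, Finset.mem_univ, true_and] at hs ⊢
  have := hp s
  omega

theorem lt_card_filter_iff_of_antitone {n : ℕ} {p : Fin n → ℕ} (hp : Antitone p) (r c : ℕ) :
    r < (Finset.univ.filter fun r' => c < p r').card ↔ ∃ h : r < n, c < p ⟨r, h⟩ := by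
  constructor
  · intro h
    by_contra hcon
    have : (Finset.univ.filter fun r' => c < p r').card ≤ r := by
      rw [← Finset.card_range r]
      refine Finset.card_le_card_of_injOn (fun x : Fin n => (x : ℕ)) ?_
        Fin.val_injective.injOn
      intro x hx
      simp only [Finset.coe_filter, Finset.mem_univ, true_and, Set.mem_ofPred_eq] at hx
      simp only [Finset.coe_range, Set.mem_Iio]
      by_contra hxr
      have hr : r < n := by omega
      exact hcon ⟨hr, hx.trans_le (hp (by rw [Fin.le_def]; simpa using hxr))⟩
    omega
  · rintro ⟨hr, h⟩
    have : (Finset.Iic (⟨r, hr⟩ : Fin n)).card ≤ (Finset.univ.filter fun r' => c < p r').card := by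
      apply Finset.card_le_card
      intro x hx
      simp only [Finset.mem_filter, Finset.mem_univ, true_and, Finset.mem_Iic] at hx ⊢
      exact h.trans_le (hp hx)
    rw [Fin.card_Iic] at this
    simpa using this

/-! ### Sums of largest parts -/

theorem card_filter_perm_symm_lt {k : ℕ} (σ : Equiv.Perm (Fin k)) {t : ℕ} (ht : t ≤ k) :
    (Finset.univ.filter fun i => (σ.symm i : ℕ) < t).card = t := by
  have : (Finset.univ.filter fun i => (σ.symm i : ℕ) < t) =
      (Finset.univ.filter fun i : Fin k => (i : ℕ) < t).map σ.toEmbedding := by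
    ext i
    simp only [Finset.mem_filter, Finset.mem_univ, true_and, Finset.mem_map_equiv]
  rw [this, Finset.card_map, Fin.card_filter_val_lt]
  omega

/-- Exchange argument: a threshold `v` separates the top-ranked indices from the others, and `I \ P`
and `P \ I` have equal size. -/
theorem sum_le_sum_of_antitone_rank {k : ℕ} {α : Fin k → ℕ} {σ : Equiv.Perm (Fin k)}
    (hσ : Antitone (α ∘ σ)) (I : Finset (Fin k)) :
    ∑ i ∈ I, α i ≤ ∑ i ∈ Finset.univ.filter (fun i => (σ.symm i : ℕ) < I.card), α i := by
  set P := Finset.univ.filter (fun i => (σ.symm i : ℕ) < I.card) with hP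
  have hIk : I.card ≤ k := (Finset.card_le_univ _).trans_eq (Fintype.card_fin k)
  have hcard : P.card = I.card := card_filter_perm_symm_lt σ hIk
  obtain ⟨v, hv1, hv2⟩ : ∃ v, (∀ i ∈ P, v ≤ α i) ∧ ∀ i ∉ P, α i ≤ v := by
    by_cases hI : I.card = k
    · refine ⟨0, by simp, fun i hi => (hi ?_).elim⟩
      simp [hP, hI]
    · refine ⟨α (σ ⟨I.card, by omega⟩), fun i hi => ?_, fun i hi => ?_⟩
      · simp only [hP, Finset.mem_filter, Finset.mem_univ, true_and] at hi
        have := hσ (show σ.symm i ≤ ⟨I.card, by omega⟩ by rw [Fin.le_def]; exact hi.le)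
        simpa using this
      · simp only [hP, Finset.mem_filter, Finset.mem_univ, true_and, not_lt] at hi
        have := hσ (show ⟨I.card, by omega⟩ ≤ σ.symm i by rw [Fin.le_def]; exact hi)
        simpa using this
  have h1 : (I \ P).card = (P \ I).card := by
    have := Finset.card_sdiff_add_card_inter I P
    have := Finset.card_sdiff_add_card_inter P I
    rw [Finset.inter_comm] at this
    omega
  have h2 : ∑ i ∈ I \ P, α i ≤ (I \ P).card * v := by
    rw [← smul_eq_mul]
    exact Finset.sum_le_card_nsmul _ _ _ fun i hi => hv2 i (Finset.mem_sdiff.1 hi).2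
  have h3 : (P \ I).card * v ≤ ∑ i ∈ P \ I, α i := by
    rw [← smul_eq_mul]
    exact Finset.card_nsmul_le_sum _ _ _ fun i hi => hv1 i (Finset.mem_sdiff.1 hi).1
  have h4 := Finset.sum_inter_add_sum_sdiff I P α
  have h5 := Finset.sum_inter_add_sum_sdiff P I α
  rw [Finset.inter_comm] at h5
  rw [h1] at h2
  omega

/-! ### Tableaux from chains of diagrams -/

theorem toLex_le_of_finSumFinEquiv_le {k ℓ : ℕ} {x y : Fin k ⊕ Fin ℓ}
    (h : (finSumFinEquiv x : ℕ) ≤ finSumFinEquiv y) : toLex x ≤ toLex y := by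
  rcases x with x | x <;> rcases y with y | y
  · exact Sum.Lex.inl_le_inl_iff.2 (Fin.le_def.2 (by simpa using h))
  · exact Sum.Lex.inl_le_inr _ _
  · simp at h
    omega
  · exact Sum.Lex.inr_le_inr_iff.2 (Fin.le_def.2 (by simpa using h))

/-- A chain of Young diagrams that grows first by `k` horizontal strips and then by `ℓ` vertical
strips gives a super semistandard tableau. -/
theorem exists_tableau_of_chain {k ℓ : ℕ} {μ : YoungDiagram} {G : ℕ → Finset (ℕ × ℕ)}
    (hmono : Monotone G) (h0 : G 0 = ∅) (hlast : G (k + ℓ) = μ.cells)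
    (hlow : ∀ s r c r' c', r' ≤ r → c' ≤ c → (r, c) ∈ G s → (r', c') ∈ G s)
    (ht : ∀ s < k, ∀ r c, (r + 1, c) ∈ G (s + 1) → (r, c) ∈ G s)
    (hu : ∀ s, k ≤ s → ∀ r c, (r, c + 1) ∈ G (s + 1) → (r, c) ∈ G s) :
    ∃ T : {c // c ∈ μ.cells} → Fin k ⊕ Fin ℓ, IsSuperSemistandard T ∧
      ∀ s, letterCount T s + (G (finSumFinEquiv s)).card = (G (finSumFinEquiv s + 1)).card := by
  classical
  have hex : ∀ x : {c // c ∈ μ.cells}, ∃ s : Fin (k + ℓ), ∀ t, x.1 ∈ G t ↔ (s : ℕ) < t := by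
    intro x
    have hx : ∃ s, x.1 ∈ G s := ⟨k + ℓ, hlast.symm ▸ x.2⟩
    have hpos : Nat.find hx ≠ 0 := by
      intro h
      have := Nat.find_spec hx
      rw [h, h0] at this
      exact absurd this (Finset.notMem_empty _)
    have hle : Nat.find hx ≤ k + ℓ := Nat.find_min' hx (hlast.symm ▸ x.2)
    -- A cell first present in `G (s + 1)` gets letter number `s`; since `G 0` is empty, the
    -- subtraction does not truncate.
    refine ⟨⟨Nat.find hx - 1, by omega⟩, fun t => ⟨fun h => ?_, fun h => ?_⟩⟩
    · have := Nat.find_min' hx h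
      simp only
      omega
    · simp only at h
      exact hmono (show Nat.find hx ≤ t by omega) (Nat.find_spec hx)
  choose N hN using hex
  let T : {c // c ∈ μ.cells} → Fin k ⊕ Fin ℓ := fun x => finSumFinEquiv.symm (N x)
  have hT : ∀ x s, T x = s ↔ N x = finSumFinEquiv s := fun x s => Equiv.symm_apply_eq _
  have hTle : ∀ x y : {c // c ∈ μ.cells}, (N x : ℕ) ≤ N y → toLex (T x) ≤ toLex (T y) := by
    intro x y h
    apply toLex_le_of_finSumFinEquiv_le
    simpa [T] using h
  have hmem : ∀ x : {c // c ∈ μ.cells}, x.1 ∈ G (N x + 1) :=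
    fun x => (hN x _).2 (Nat.lt_succ_self _)
  refine ⟨T, ⟨?_, ?_, ?_, ?_⟩, ?_⟩
  · intro c d h1 h2
    apply hTle
    exact Nat.lt_succ_iff.1 ((hN c _).1 (hlow _ _ _ _ _ h1.le h2.le (hmem d)))
  · intro c d h1 h2
    apply hTle
    exact Nat.lt_succ_iff.1 ((hN c _).1 (hlow _ _ _ _ _ h2.le h1.le (hmem d)))
  · intro c d h1 h2 i i' hc hd
    rw [hT] at hc hd
    have hd' : (d.1.1 - 1 + 1, d.1.2) ∈ G ((N d : ℕ) + 1) := by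
      rw [Nat.sub_add_cancel (by omega)]
      exact hmem d
    have h3 : (N d : ℕ) = i' := by rw [hd]; simp
    have h4 : (N c : ℕ) = i := by rw [hc]; simp
    have := (hN c _).1 (hlow _ _ _ c.1.1 c.1.2 (by omega) h1.le (ht _ (by omega) _ _ hd'))
    rw [Fin.lt_def]
    omega
  · intro c d h1 h2 i i' hc hd
    rw [hT] at hc hd
    have hd' : (d.1.1, d.1.2 - 1 + 1) ∈ G ((N d : ℕ) + 1) := by
      rw [Nat.sub_add_cancel (by omega)]
      exact hmem d
    have h3 : (N d : ℕ) = k + i' := by rw [hd]; simp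
    have h4 : (N c : ℕ) = k + i := by rw [hc]; simp
    have := (hN c _).1 (hlow _ _ _ c.1.1 c.1.2 h1.le (by omega) (hu _ (by omega) _ _ hd'))
    rw [Fin.lt_def]
    omega
  · intro s
    have hsub : G (finSumFinEquiv s + 1) ⊆ μ.cells := by
      rw [← hlast]
      exact hmono (finSumFinEquiv s).2
    have : letterCount T s =
        (G (finSumFinEquiv s + 1) \ G (finSumFinEquiv s)).card := by
      unfold letterCount
      refine Finset.card_bij (fun x _ => x.1) ?_ (fun x _ y _ h => Subtype.ext h) ?_
      · intro x hx
        rw [Finset.mem_filter, hT] at hx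
        rw [Finset.mem_sdiff, hN, hN, hx.2]
        omega
      · intro x hx
        rw [Finset.mem_sdiff] at hx
        refine ⟨⟨x, hsub hx.1⟩, ?_, rfl⟩
        rw [Finset.mem_filter, hT, Fin.ext_iff]
        have h1 := (hN ⟨x, hsub hx.1⟩ _).1 hx.1
        have h2 := mt (hN ⟨x, hsub hx.1⟩ _).2 hx.2
        exact ⟨Finset.mem_univ _, by omega⟩
    rw [this]
    exact Finset.card_sdiff_add_card_eq_card (hmono (Nat.le_succ _))

/-! ### Partial counts along a family of sets -/

/-- The number of sets among the first `s` of the family `V` that contain `c`. -/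
def partialCount {k : ℕ} {R : Type*} [DecidableEq R] (V : Fin k → Finset R) (s : ℕ) (c : R) : ℕ :=
  (Finset.univ.filter fun i : Fin k => (i : ℕ) < s ∧ c ∈ V i).card

theorem partialCount_zero {k : ℕ} {R : Type*} [DecidableEq R] (V : Fin k → Finset R) (c : R) :
    partialCount V 0 c = 0 := by
  simp [partialCount]

theorem partialCount_self {k : ℕ} {R : Type*} [DecidableEq R] (V : Fin k → Finset R) (c : R) :
    partialCount V k c = (Finset.univ.filter fun i => c ∈ V i).card := by
  simp [partialCount]

theorem partialCount_mono {k : ℕ} {R : Type*} [DecidableEq R] (V : Fin k → Finset R) {s t : ℕ}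
    (h : s ≤ t) (c : R) : partialCount V s c ≤ partialCount V t c := by
  apply Finset.card_le_card
  intro i hi
  simp only [Finset.mem_filter, Finset.mem_univ, true_and] at hi ⊢
  exact ⟨hi.1.trans_le h, hi.2⟩

theorem partialCount_le {k : ℕ} {R : Type*} [DecidableEq R] (V : Fin k → Finset R) (s : ℕ)
    (c : R) : partialCount V s c ≤ (Finset.univ.filter fun i => c ∈ V i).card := by
  apply Finset.card_le_card
  intro i hi
  simp only [Finset.mem_filter, Finset.mem_univ, true_and] at hi ⊢
  exact hi.2

theorem partialCount_succ {k : ℕ} {R : Type*} [DecidableEq R] (V : Fin k → Finset R) (i : Fin k)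
    (c : R) : partialCount V (i + 1) c = partialCount V i c + if c ∈ V i then 1 else 0 := by
  have h : (Finset.univ.filter fun i' : Fin k => (i' : ℕ) < i + 1 ∧ c ∈ V i') =
      (Finset.univ.filter fun i' : Fin k => (i' : ℕ) < i ∧ c ∈ V i') ∪
        ({i} : Finset (Fin k)).filter fun i' => c ∈ V i' := by
    ext i'
    simp only [Finset.mem_filter, Finset.mem_univ, true_and, Finset.mem_union,
      Finset.mem_singleton, Fin.ext_iff]
    by_cases hc : c ∈ V i'
    · simp only [hc, and_true]
      omega
    · simp [hc]
  rw [partialCount, h, Finset.card_union_of_disjoint, Finset.filter_singleton]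
  · congr 1
    split_ifs <;> simp
  · rw [Finset.disjoint_left]
    intro i' h1 h2
    simp only [Finset.mem_filter, Finset.mem_singleton] at h1 h2
    rw [h2.1] at h1
    omega

theorem partialCount_succ_le {k : ℕ} {R : Type*} [DecidableEq R] (V : Fin k → Finset R) (s : ℕ)
    (c : R) : partialCount V (s + 1) c ≤ partialCount V s c + 1 := by
  by_cases hs : s < k
  · rw [partialCount_succ V ⟨s, hs⟩]
    simp only
    split_ifs <;> omega
  · have := partialCount_le V (s + 1) c
    have := partialCount_mono V (not_lt.1 hs) c
    rw [partialCount_self] at this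
    omega

theorem sum_partialCount_succ {k : ℕ} {R : Type*} [Fintype R] [DecidableEq R]
    (V : Fin k → Finset R) (i : Fin k) :
    ∑ c, partialCount V (i + 1) c = (V i).card + ∑ c, partialCount V i c := by
  simp only [partialCount_succ, Finset.sum_add_distrib, Finset.sum_boole, Finset.filter_univ_mem,
    Nat.cast_id]
  omega

theorem sum_card_filter_mem {κ R : Type*} [Fintype κ] [Fintype R] [DecidableEq R]
    (U : κ → Finset R) :
    ∑ r, (Finset.univ.filter fun j => r ∈ U j).card = ∑ j, (U j).card := by
  simp only [Finset.card_filter]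
  rw [Finset.sum_comm]
  simp

/-! ### Sufficiency of the hook inequalities -/

theorem sortedShape_rowLen (μ : YoungDiagram) :
    sortedShape (μ.colLen 0) (μ.rowLen 0) (fun r => μ.rowLen r) = μ.cells := by
  ext ⟨r, c⟩
  rw [mem_sortedShape, lt_card_filter_iff_of_antitone (fun a b h => μ.rowLen_anti a b h),
    YoungDiagram.mem_cells]
  simp only [exists_prop]
  constructor
  · rintro ⟨-, -, h⟩
    exact YoungDiagram.mem_iff_lt_rowLen.2 h
  · intro h
    exact ⟨YoungDiagram.mem_iff_lt_rowLen.1 (μ.up_left_mem (Nat.zero_le _) le_rfl h),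
      YoungDiagram.mem_iff_lt_colLen.1 (μ.up_left_mem le_rfl (Nat.zero_le _) h),
      YoungDiagram.mem_iff_lt_rowLen.1 h⟩

/-- The cells of `μ` in its first `i` rows or first `j` columns. -/
def hookCells (μ : YoungDiagram) (i j : ℕ) : Finset (ℕ × ℕ) :=
  μ.cells.filter fun x => x.1 < i ∨ x.2 < j

/-- A row of `Q` contributes at most its whole length. A row outside `Q` has index at least `i`, so
it meets the hook only in the first `j` columns. -/
theorem card_hookCells_le (μ : YoungDiagram) (i j : ℕ) (Q : Finset (Fin (μ.colLen 0)))
    (hQ : ∀ r : Fin (μ.colLen 0), (r : ℕ) < i → r ∈ Q) :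
    (hookCells μ i j).card ≤ ∑ r ∈ Q, μ.rowLen r + j * Qᶜ.card := by
  have hn : ∀ x ∈ μ.cells, x.1 < μ.colLen 0 := fun x hx =>
    YoungDiagram.mem_iff_lt_colLen.1 (μ.up_left_mem le_rfl (Nat.zero_le _) hx)
  calc (hookCells μ i j).card
      ≤ ((Q.sigma fun r => Finset.range (μ.rowLen r)).disjSum (Finset.range j ×ˢ Qᶜ)).card := by
        refine Finset.card_le_card_of_surjOn
          (fun y => Sum.elim (fun y => ((y.1 : ℕ), y.2)) (fun y => ((y.2 : ℕ), y.1)) y) ?_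
        rintro ⟨r, c⟩ hx
        rw [Finset.mem_coe, hookCells, Finset.mem_filter] at hx
        have hr := hn _ hx.1
        by_cases hrQ : (⟨r, hr⟩ : Fin (μ.colLen 0)) ∈ Q
        · refine ⟨Sum.inl ⟨⟨r, hr⟩, c⟩, ?_, rfl⟩
          rw [Finset.mem_coe, Finset.inl_mem_disjSum, Finset.mem_sigma, Finset.mem_range]
          exact ⟨hrQ, YoungDiagram.mem_iff_lt_rowLen.1 hx.1⟩
        · refine ⟨Sum.inr ⟨c, ⟨r, hr⟩⟩, ?_, rfl⟩
          rw [Finset.mem_coe, Finset.inr_mem_disjSum, Finset.mem_product, Finset.mem_range,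
            Finset.mem_compl]
          exact ⟨hx.2.resolve_left fun h => hrQ (hQ _ h), hrQ⟩
    _ = _ := by simp

/-- Both stages use the flow lemma: `U` places the `u`-letters in rows, and `V` places the
`t`-letters in columns, with the conjugate of `m` as column capacities. -/
theorem exists_assignment_of_hook_inequalities {k ℓ : ℕ} {μ : YoungDiagram} (α : Fin k → ℕ)
    (β : Fin ℓ → ℕ) (htot : ∑ i, α i + ∑ j, β j = μ.card)
    (h : ∀ (I : Finset (Fin k)) (J : Finset (Fin ℓ)),
      ∑ i ∈ I, α i + ∑ j ∈ J, β j ≤ (hookCells μ I.card J.card).card) :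
    ∃ (U : Fin ℓ → Finset (Fin (μ.colLen 0))) (V : Fin k → Finset (Fin (μ.rowLen 0)))
      (m : Fin (μ.colLen 0) → ℕ), (∀ j, (U j).card = β j) ∧ (∀ i, (V i).card = α i) ∧
      (∀ r, m r + (Finset.univ.filter fun j => r ∈ U j).card = μ.rowLen r) ∧
      ∀ c : Fin (μ.rowLen 0), (Finset.univ.filter fun i => c ∈ V i).card =
        (Finset.univ.filter fun r => (c : ℕ) < m r).card := by
  obtain ⟨σ, hσ⟩ : ∃ σ : Equiv.Perm (Fin k), Antitone (α ∘ σ) :=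
    ⟨Tuple.sort (OrderDual.toDual ∘ α), fun a b hab =>
      Tuple.monotone_sort (OrderDual.toDual ∘ α) hab⟩
  -- The `t`-letter of rank `s`, counted from the most frequent, is confined to rows `0, …, s`. The
  -- residual inequality then says that the `s` largest multiplicities fit into the first `s` values
  -- of `m`.
  obtain ⟨U, hU, hUQ⟩ := exists_capacitated_assignment
    (fun r : Fin (μ.colLen 0) => μ.rowLen r)
    (fun i : Fin k => Finset.univ.filter fun r => (r : ℕ) ≤ σ.symm i) α β (by
      intro I J Q hIQ
      -- The highest rank in `I` determines `t`. Enlarging `I` to all letters of rank below `t` adds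
      -- no rows, so the hook inequality for that set suffices.
      obtain ⟨t, htk, hIt, htQ⟩ : ∃ t ≤ k, (∀ i ∈ I, (σ.symm i : ℕ) < t) ∧
          ∀ r : Fin (μ.colLen 0), (r : ℕ) < t → r ∈ Q := by
        rcases I.eq_empty_or_nonempty with rfl | hI
        · exact ⟨0, Nat.zero_le _, by simp, by simp⟩
        · obtain ⟨i₀, hi₀, hmax⟩ := I.exists_max_image (fun i => (σ.symm i : ℕ)) hI
          refine ⟨σ.symm i₀ + 1, (σ.symm i₀).2, fun i hi => Nat.lt_succ_of_le (hmax i hi),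
            fun r hr => hIQ i₀ hi₀ ?_⟩
          simp only [Finset.mem_filter, Finset.mem_univ, true_and]
          omega
      have h1 := h (Finset.univ.filter fun i => (σ.symm i : ℕ) < t) J
      rw [card_filter_perm_symm_lt σ htk] at h1
      have h2 : ∑ i ∈ I, α i ≤ ∑ i ∈ Finset.univ.filter (fun i => (σ.symm i : ℕ) < t), α i :=
        Finset.sum_le_sum_of_subset fun i hi => by simpa using hIt i hi
      have h3 := card_hookCells_le μ t J.card Q htQ
      omega)
  have hUr : ∀ r : Fin (μ.colLen 0), (Finset.univ.filter fun j => r ∈ U j).card ≤ μ.rowLen r := by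
    intro r
    simpa using hUQ ∅ {r} (by simp)
  set m : Fin (μ.colLen 0) → ℕ :=
    fun r => μ.rowLen r - (Finset.univ.filter fun j => r ∈ U j).card with hm
  have hmr : ∀ r, m r + (Finset.univ.filter fun j => r ∈ U j).card = μ.rowLen r :=
    fun r => Nat.sub_add_cancel (hUr r)
  have hlam : ∑ r : Fin (μ.colLen 0), μ.rowLen r = μ.card := by
    rw [← card_sortedShape (n := μ.colLen 0) (w := μ.rowLen 0) (p := fun r => μ.rowLen r)
      (fun r => μ.rowLen_anti _ _ (Nat.zero_le _)), sortedShape_rowLen]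
  have hmw : ∀ r, m r ≤ μ.rowLen 0 := fun r =>
    (Nat.sub_le _ _).trans (μ.rowLen_anti _ _ (Nat.zero_le _))
  have hmsum : ∑ r, m r = ∑ i, α i := by
    have h1 : ∑ r, m r + ∑ j, β j = μ.card := by
      rw [← hlam, ← Finset.sum_congr rfl fun j _ => hU j, ← sum_card_filter_mem,
        ← Finset.sum_add_distrib]
      exact Finset.sum_congr rfl fun r _ => hmr r
    omega
  -- No letters of the first kind occur here, so the condition is that of Gale–Ryser: columns
  -- outside `Q` meet the first `J.card` rows in at most `J.card` cells each.
  obtain ⟨V, hV, hVQ⟩ := exists_capacitated_assignment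
    (fun c : Fin (μ.rowLen 0) => (Finset.univ.filter fun r => (c : ℕ) < m r).card)
    (fun _ : Fin 0 => ∅) (fun _ => 0) α (by
      intro I J Q _
      set P : Finset (Fin (μ.colLen 0)) := Finset.univ.filter fun r => (r : ℕ) < J.card with hP
      have hPJ : P.card ≤ J.card := by
        rw [hP, Fin.card_filter_val_lt]
        exact min_le_right _ _
      have h1 := hUQ (Finset.univ.filter fun i => (σ.symm i : ℕ) < J.card) P (by
        intro i hi r hr
        simp only [hP, Finset.mem_filter, Finset.mem_univ, true_and] at hi hr ⊢
        omega)
      have h2 := sum_le_sum_of_antitone_rank hσ J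
      have h3 : ∑ r ∈ P, m r + ∑ r ∈ P, (Finset.univ.filter fun j => r ∈ U j).card =
          ∑ r ∈ P, μ.rowLen r := by
        rw [← Finset.sum_add_distrib]
        exact Finset.sum_congr rfl fun r _ => hmr r
      have h4 : ∑ r ∈ P, m r = ∑ c : Fin (μ.rowLen 0), (P.filter fun r => (c : ℕ) < m r).card := by
        rw [← sum_card_filter_lt P hmw, Finset.sum_range]
      have h5 : ∑ c ∈ Q, (P.filter fun r => (c : ℕ) < m r).card ≤
          ∑ c ∈ Q, (Finset.univ.filter fun r => (c : ℕ) < m r).card :=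
        Finset.sum_le_sum fun c _ => Finset.card_le_card
          (Finset.filter_subset_filter _ (Finset.subset_univ _))
      have h6 : ∑ c ∈ Qᶜ, (P.filter fun r => (c : ℕ) < m r).card ≤ Qᶜ.card * J.card := by
        rw [← smul_eq_mul]
        exact Finset.sum_le_card_nsmul _ _ _ fun c _ =>
          (Finset.card_le_card (Finset.filter_subset _ _)).trans hPJ
      have h7 := Finset.sum_add_sum_compl Q
        fun c : Fin (μ.rowLen 0) => (P.filter fun r => (c : ℕ) < m r).card
      rw [mul_comm] at h6
      simp only [Finset.sum_const_zero, zero_add]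
      omega)
  refine ⟨U, V, m, hU, hV, hmr, ?_⟩
  -- Capacities give only an upper bound in each column; equality of the totals forces equality
  -- everywhere.
  have hVc : ∀ c ∈ (Finset.univ : Finset (Fin (μ.rowLen 0))),
      (Finset.univ.filter fun i => c ∈ V i).card ≤
        (Finset.univ.filter fun r => (c : ℕ) < m r).card := by
    intro c _
    simpa using hVQ ∅ {c} (by simp)
  have hsum : ∑ c, (Finset.univ.filter fun i => c ∈ V i).card =
      ∑ c : Fin (μ.rowLen 0), (Finset.univ.filter fun r => (c : ℕ) < m r).card := by
    rw [sum_card_filter_mem, Finset.sum_congr rfl fun i _ => hV i, ← hmsum,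
      ← sum_card_filter_lt Finset.univ hmw, Finset.sum_range]
  intro c
  exact (Finset.sum_eq_sum_iff_of_le hVc).1 hsum c (Finset.mem_univ c)

theorem exists_tableau_of_hook_inequalities {k ℓ : ℕ} {μ : YoungDiagram} (α : Fin k → ℕ)
    (β : Fin ℓ → ℕ) (htot : ∑ i, α i + ∑ j, β j = μ.card)
    (h : ∀ (I : Finset (Fin k)) (J : Finset (Fin ℓ)),
      ∑ i ∈ I, α i + ∑ j ∈ J, β j ≤ (hookCells μ I.card J.card).card) :
    ∃ T : {c // c ∈ μ.cells} → Fin k ⊕ Fin ℓ, IsSuperSemistandard T ∧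
      (∀ i, letterCount T (Sum.inl i) = α i) ∧ ∀ j, letterCount T (Sum.inr j) = β j := by
  obtain ⟨U, V, m, hU, hV, hm, hVm⟩ := exists_assignment_of_hook_inequalities α β htot h
  let n := μ.colLen 0
  let w := μ.rowLen 0
  let p : ℕ → Fin n → ℕ := fun s r => m r + partialCount U s r
  -- The `t`-letters are assigned to columns, so column lengths are sorted and the shape is
  -- transposed; the strips become horizontal. The two halves of the chain agree at `k` because the
  -- column counts of `V` are conjugate to `m`.
  let tShape : ℕ → Finset (ℕ × ℕ) := fun s =>
    (sortedShape w n (partialCount V s)).map (Equiv.prodComm ℕ ℕ).toEmbedding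
  have mem_tShape : ∀ s r c, (r, c) ∈ tShape s ↔ (c, r) ∈ sortedShape w n (partialCount V s) := by
    intro s r c
    simp only [tShape, Finset.mem_map_equiv]
    rfl
  let G : ℕ → Finset (ℕ × ℕ) := fun s => if s ≤ k then tShape s else sortedShape n w (p (s - k))
  have hp0 : p 0 = m := by
    funext r
    simp [p, partialCount_zero]
  have hVk : partialCount V k =
      fun c : Fin w => (Finset.univ.filter fun r => (c : ℕ) < m r).card := by
    funext c
    rw [partialCount_self, hVm]
  have hmid : tShape k = sortedShape n w (p 0) := by
    ext ⟨r, c⟩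
    have hle : (Finset.univ.filter fun r' => c < m r').card ≤ n :=
      (Finset.card_le_univ _).trans_eq (Fintype.card_fin n)
    have hanti : Antitone
        (fun c : Fin w => (Finset.univ.filter fun r => (c : ℕ) < m r).card) := by
      intro a b hab
      apply Finset.card_le_card
      intro r hr
      simp only [Finset.mem_filter, Finset.mem_univ, true_and] at hr ⊢
      exact lt_of_le_of_lt hab hr
    rw [mem_tShape, mem_sortedShape, mem_sortedShape, hVk, hp0,
      lt_card_filter_iff_of_antitone hanti]
    simp only [exists_prop]
    constructor
    · exact fun h => h.2
    · exact fun h => ⟨h.2.trans_le hle, h⟩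
  have hGt : ∀ s ≤ k, G s = tShape s := fun s hs => if_pos hs
  have hGu : ∀ s, k ≤ s → G s = sortedShape n w (p (s - k)) := by
    intro s hs
    rcases hs.eq_or_lt with rfl | hs
    · rw [hGt _ le_rfl, hmid, Nat.sub_self]
    · exact if_neg (not_le.2 hs)
  have hpw : ∀ s r, p s r ≤ w := by
    intro s r
    have h1 := partialCount_le U s r
    have h2 := hm r
    have h3 : μ.rowLen r ≤ w := μ.rowLen_anti _ _ (Nat.zero_le _)
    simp only [p]
    omega
  have hqn : ∀ s c, partialCount V s c ≤ n := by
    intro s c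
    refine (partialCount_le V s c).trans ?_
    rw [hVm]
    exact (Finset.card_le_univ _).trans_eq (Fintype.card_fin n)
  have hmono : Monotone G := by
    apply monotone_nat_of_le_succ
    intro s
    rcases lt_or_ge s k with hs | hs
    · rw [hGt s hs.le, hGt (s + 1) hs]
      exact Finset.map_subset_map.2 (sortedShape_mono (partialCount_mono V (Nat.le_succ s)))
    · rw [hGu s hs, hGu (s + 1) (by omega)]
      exact sortedShape_mono fun r =>
        Nat.add_le_add_left (partialCount_mono U (by omega) r) _
  obtain ⟨T, hT, hcount⟩ := exists_tableau_of_chain (k := k) (ℓ := ℓ) (μ := μ) hmono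
    (by
      rw [hGt 0 (Nat.zero_le _)]
      ext ⟨r, c⟩
      rw [mem_tShape, mem_sortedShape]
      simp [partialCount_zero])
    (by
      rw [hGu _ (Nat.le_add_right _ _), ← sortedShape_rowLen]
      congr 1
      funext r
      rw [Nat.add_sub_cancel_left]
      simp only [p, partialCount_self]
      exact hm r)
    (by
      intro s r c r' c' hr hc hx
      rcases lt_or_ge s k with hs | hs
      · rw [hGt s hs.le, mem_tShape] at hx ⊢
        exact sortedShape_lower hc hr hx
      · rw [hGu s hs] at hx ⊢
        exact sortedShape_lower hr hc hx)
    (by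
      intro s hs r c hx
      rw [hGt _ hs, mem_tShape] at hx
      rw [hGt _ hs.le, mem_tShape]
      exact sortedShape_strip (partialCount_succ_le V s) hx)
    (by
      intro s hs r c hx
      rw [hGu _ (by omega), Nat.sub_add_comm hs] at hx
      rw [hGu _ hs]
      refine sortedShape_strip (fun r => ?_) hx
      have := partialCount_succ_le U (s - k) r
      simp only [p]
      omega)
  refine ⟨T, hT, fun i => ?_, fun j => ?_⟩
  · have h1 := hcount (Sum.inl i)
    rw [finSumFinEquiv_apply_left, Fin.val_castAdd, hGt _ i.2.le, hGt _ i.2] at h1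
    simp only [tShape, Finset.card_map] at h1
    rw [card_sortedShape (hqn _), card_sortedShape (hqn _), sum_partialCount_succ, hV] at h1
    omega
  · have h1 := hcount (Sum.inr j)
    rw [finSumFinEquiv_apply_right, Fin.val_natAdd, hGu _ (by omega), hGu _ (by omega),
      card_sortedShape (hpw _), card_sortedShape (hpw _), Nat.add_assoc, Nat.add_sub_cancel_left,
      Nat.add_sub_cancel_left] at h1
    simp only [p, Finset.sum_add_distrib] at h1
    rw [sum_partialCount_succ, hU] at h1
    omega

/-! ### Necessity of the hook inequalities -/

theorem sum_letterCount {k ℓ : ℕ} {μ : YoungDiagram} (T : {c // c ∈ μ.cells} → Fin k ⊕ Fin ℓ)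
    (S : Finset (Fin k ⊕ Fin ℓ)) :
    ∑ s ∈ S, letterCount T s = (Finset.univ.filter fun x => T x ∈ S).card := by
  rw [Finset.card_eq_sum_card_fiberwise (f := T) (t := S) (fun x hx => by simpa using hx)]
  refine Finset.sum_congr rfl fun s hs => ?_
  rw [letterCount, Finset.filter_filter]
  congr 1
  ext x
  simp only [Finset.mem_filter, Finset.mem_univ, true_and]
  exact ⟨fun h => ⟨h ▸ hs, h⟩, fun h => h.2⟩

namespace IsSuperSemistandard

variable {k ℓ : ℕ} {μ : YoungDiagram} {T : {c // c ∈ μ.cells} → Fin k ⊕ Fin ℓ}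

theorem isLeft_of_above (hT : IsSuperSemistandard T) {x y : {c // c ∈ μ.cells}}
    (hc : y.1.2 = x.1.2) (hr : y.1.1 ≤ x.1.1) (hx : (T x).isLeft) : (T y).isLeft := by
  rcases hr.eq_or_lt with hr | hr
  · rwa [show y = x from Subtype.ext (Prod.ext hr hc)]
  · have h := hT.col_weak y x hc hr
    obtain ⟨i, hi⟩ := Sum.isLeft_iff.1 hx
    rw [hi] at h
    rcases hy : T y with i' | j
    · rfl
    · rw [hy] at h
      exact absurd h Sum.Lex.not_inr_le_inl

/-- The number of cells above `x` in its column with letters in `S`. -/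
def countAbove (T : {c // c ∈ μ.cells} → Fin k ⊕ Fin ℓ) (S : Finset (Fin k ⊕ Fin ℓ))
    (x : {c // c ∈ μ.cells}) : ℕ :=
  (Finset.univ.filter fun y : {c // c ∈ μ.cells} =>
    y.1.2 = x.1.2 ∧ y.1.1 < x.1.1 ∧ T y ∈ S).card

/-- The number of cells to the left of `x` in its row with `u`-letters in `S`. -/
def countLeft (T : {c // c ∈ μ.cells} → Fin k ⊕ Fin ℓ) (S : Finset (Fin k ⊕ Fin ℓ))
    (x : {c // c ∈ μ.cells}) : ℕ :=
  (Finset.univ.filter fun y : {c // c ∈ μ.cells} =>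
    y.1.1 = x.1.1 ∧ y.1.2 < x.1.2 ∧ T y ∈ S ∧ (T y).isRight).card

theorem countAbove_le (S : Finset (Fin k ⊕ Fin ℓ)) (x : {c // c ∈ μ.cells}) :
    countAbove T S x ≤ x.1.1 := by
  rw [← Finset.card_range x.1.1]
  refine Finset.card_le_card_of_injOn (fun y => y.1.1) ?_ ?_
  · intro y hy
    simp only [Finset.coe_filter, Finset.mem_univ, true_and, Set.mem_ofPred_eq] at hy
    simpa using hy.2.1
  · intro y hy z hz hyz
    simp only [Finset.coe_filter, Finset.mem_univ, true_and, Set.mem_ofPred_eq] at hy hz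
    exact Subtype.ext (Prod.ext hyz (hy.1.trans hz.1.symm))

theorem countLeft_le (S : Finset (Fin k ⊕ Fin ℓ)) (x : {c // c ∈ μ.cells}) :
    countLeft T S x ≤ x.1.2 := by
  rw [← Finset.card_range x.1.2]
  refine Finset.card_le_card_of_injOn (fun y => y.1.2) ?_ ?_
  · intro y hy
    simp only [Finset.coe_filter, Finset.mem_univ, true_and, Set.mem_ofPred_eq] at hy
    simpa using hy.2.1
  · intro y hy z hz hyz
    simp only [Finset.coe_filter, Finset.mem_univ, true_and, Set.mem_ofPred_eq] at hy hz
    exact Subtype.ext (Prod.ext (hy.1.trans hz.1.symm) hyz)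

theorem countAbove_lt_countAbove {S : Finset (Fin k ⊕ Fin ℓ)} {x y : {c // c ∈ μ.cells}}
    (hc : x.1.2 = y.1.2) (hr : x.1.1 < y.1.1) (hx : T x ∈ S) :
    countAbove T S x < countAbove T S y := by
  refine Finset.card_lt_card (Finset.ssubset_iff_of_subset ?_ |>.2 ⟨x, ?_, ?_⟩)
  · intro z hz
    simp only [Finset.mem_filter, Finset.mem_univ, true_and] at hz ⊢
    exact ⟨hz.1.trans hc, hz.2.1.trans hr, hz.2.2⟩
  · simp [hc, hr, hx]
  · simp

theorem countLeft_lt_countLeft {S : Finset (Fin k ⊕ Fin ℓ)} {x y : {c // c ∈ μ.cells}}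
    (hr : x.1.1 = y.1.1) (hc : x.1.2 < y.1.2) (hx : T x ∈ S) (hxr : (T x).isRight) :
    countLeft T S x < countLeft T S y := by
  refine Finset.card_lt_card (Finset.ssubset_iff_of_subset ?_ |>.2 ⟨x, ?_, ?_⟩)
  · intro z hz
    simp only [Finset.mem_filter, Finset.mem_univ, true_and] at hz ⊢
    exact ⟨hz.1.trans hr, hz.2.1.trans hc, hz.2.2⟩
  · simp [hc, hr, hx, hxr]
  · simp

/-- Everything above a `t`-letter in its column is a smaller `t`-letter, so the cells counted carry
distinct letters of `S` other than that of `x`. -/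
theorem countAbove_lt (hT : IsSuperSemistandard T) {S : Finset (Fin k ⊕ Fin ℓ)}
    {x : {c // c ∈ μ.cells}} (hx : T x ∈ S) (hxl : (T x).isLeft) :
    countAbove T S x < S.toLeft.card := by
  obtain ⟨i, hi⟩ := Sum.isLeft_iff.1 hxl
  have hmem : Sum.inl i ∈ S := hi ▸ hx
  have hpos : i ∈ S.toLeft := Finset.mem_toLeft.2 hmem
  have hle : countAbove T S x ≤ ((S.toLeft.erase i).map Function.Embedding.inl :
      Finset (Fin k ⊕ Fin ℓ)).card := by
    refine Finset.card_le_card_of_injOn T ?_ ?_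
    · intro y hy
      simp only [Finset.coe_filter, Finset.mem_univ, true_and, Set.mem_ofPred_eq] at hy
      obtain ⟨i', hi'⟩ := Sum.isLeft_iff.1 (hT.isLeft_of_above hy.1 hy.2.1.le hxl)
      have := hT.t_col_strict y x hy.1 hy.2.1 i' i hi' hi
      have h2 := hy.2.2
      rw [hi'] at h2
      simp [hi', this.ne, h2]
    · intro y hy z hz hyz
      simp only [Finset.coe_filter, Finset.mem_univ, true_and, Set.mem_ofPred_eq] at hy hz
      obtain ⟨i', hi'⟩ := Sum.isLeft_iff.1 (hT.isLeft_of_above hy.1 hy.2.1.le hxl)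
      have hcol := hy.1.trans hz.1.symm
      rcases lt_trichotomy y.1.1 z.1.1 with h | h | h
      · exact absurd (hT.t_col_strict y z hcol h i' i' hi' (hyz ▸ hi')) (lt_irrefl _)
      · exact Subtype.ext (Prod.ext h hcol)
      · exact absurd (hT.t_col_strict z y hcol.symm h i' i' (hyz ▸ hi') hi') (lt_irrefl _)
  rw [Finset.card_map, Finset.card_erase_of_mem hpos] at hle
  have := Finset.card_pos.2 ⟨i, hpos⟩
  omega

theorem countLeft_lt (hT : IsSuperSemistandard T) {S : Finset (Fin k ⊕ Fin ℓ)}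
    {x : {c // c ∈ μ.cells}} (hx : T x ∈ S) (hxr : (T x).isRight) :
    countLeft T S x < S.toRight.card := by
  obtain ⟨j, hj⟩ := Sum.isRight_iff.1 hxr
  have hmem : Sum.inr j ∈ S := hj ▸ hx
  have hpos : j ∈ S.toRight := Finset.mem_toRight.2 hmem
  have hle : countLeft T S x ≤ ((S.toRight.erase j).map Function.Embedding.inr :
      Finset (Fin k ⊕ Fin ℓ)).card := by
    refine Finset.card_le_card_of_injOn T ?_ ?_
    · intro y hy
      simp only [Finset.coe_filter, Finset.mem_univ, true_and, Set.mem_ofPred_eq] at hy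
      obtain ⟨j', hj'⟩ := Sum.isRight_iff.1 hy.2.2.2
      have := hT.u_row_strict y x hy.1 hy.2.1 j' j hj' hj
      have h2 := hy.2.2.1
      rw [hj'] at h2
      simp [hj', this.ne, h2]
    · intro y hy z hz hyz
      simp only [Finset.coe_filter, Finset.mem_univ, true_and, Set.mem_ofPred_eq] at hy hz
      obtain ⟨j', hj'⟩ := Sum.isRight_iff.1 hy.2.2.2
      have hrow := hy.1.trans hz.1.symm
      rcases lt_trichotomy y.1.2 z.1.2 with h | h | h
      · exact absurd (hT.u_row_strict y z hrow h j' j' hj' (hyz ▸ hj')) (lt_irrefl _)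
      · exact Subtype.ext (Prod.ext hrow h)
      · exact absurd (hT.u_row_strict z y hrow.symm h j' j' (hyz ▸ hj') hj') (lt_irrefl _)
  rw [Finset.card_map, Finset.card_erase_of_mem hpos] at hle
  have := Finset.card_pos.2 ⟨j, hpos⟩
  omega

/-- The injection `φ` slides `t`-cells up their columns into the first `S.toLeft.card` rows, fixes
`u`-cells already in those rows, and slides the other `u`-cells left along their rows into the first
`S.toRight.card` columns. -/
theorem sum_letterCount_le (hT : IsSuperSemistandard T) (S : Finset (Fin k ⊕ Fin ℓ)) :
    ∑ s ∈ S, letterCount T s ≤ (hookCells μ S.toLeft.card S.toRight.card).card := by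
  rw [sum_letterCount]
  let φ : {c // c ∈ μ.cells} → ℕ × ℕ := fun x =>
    if (T x).isLeft then (countAbove T S x, x.1.2)
    else if x.1.1 < S.toLeft.card then x.1 else (x.1.1, countLeft T S x)
  have hright : ∀ x, ¬ (T x).isLeft → (T x).isRight := fun x h => by simpa using h
  refine Finset.card_le_card_of_injOn φ ?_ ?_
  · intro x hx
    replace hx : T x ∈ S := by simpa using hx
    rw [Finset.mem_coe, hookCells, Finset.mem_filter]
    by_cases h1 : (T x).isLeft
    · simp only [φ, if_pos h1]
      exact ⟨μ.up_left_mem (countAbove_le S x) le_rfl x.2, Or.inl (hT.countAbove_lt hx h1)⟩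
    · by_cases h2 : x.1.1 < S.toLeft.card
      · simp only [φ, if_neg h1, if_pos h2]
        exact ⟨x.2, Or.inl h2⟩
      · simp only [φ, if_neg h1, if_neg h2]
        exact ⟨μ.up_left_mem le_rfl (countLeft_le S x) x.2,
          Or.inr (hT.countLeft_lt hx (hright x h1))⟩
  -- The image of a `t`-cell lies weakly above it, where only `t`-letters occur, so it is not a
  -- fixed `u`-cell; it also lies above every row in which `u`-cells slide.
  · have mixed : ∀ x y : {c // c ∈ μ.cells}, T x ∈ S → (T x).isLeft → ¬ (T y).isLeft →
        φ x ≠ φ y := by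
      intro x y hx hxl hyl hxy
      by_cases h2 : y.1.1 < S.toLeft.card
      · simp only [φ, if_pos hxl, if_neg hyl, if_pos h2] at hxy
        have hc : y.1.2 = x.1.2 := (congrArg Prod.snd hxy).symm
        have hr : countAbove T S x = y.1.1 := congrArg Prod.fst hxy
        exact hyl (hT.isLeft_of_above hc (hr ▸ countAbove_le S x) hxl)
      · simp only [φ, if_pos hxl, if_neg hyl, if_neg h2] at hxy
        have hr : countAbove T S x = y.1.1 := congrArg Prod.fst hxy
        have := hT.countAbove_lt hx hxl
        omega
    intro x hx y hy hxy
    replace hx : T x ∈ S := by simpa using hx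
    replace hy : T y ∈ S := by simpa using hy
    by_cases hxl : (T x).isLeft <;> by_cases hyl : (T y).isLeft
    · simp only [φ, if_pos hxl, if_pos hyl, Prod.mk.injEq] at hxy
      rcases lt_trichotomy x.1.1 y.1.1 with h | h | h
      · exact absurd hxy.1 (countAbove_lt_countAbove hxy.2 h hx).ne
      · exact Subtype.ext (Prod.ext h hxy.2)
      · exact absurd hxy.1 (countAbove_lt_countAbove hxy.2.symm h hy).ne'
    · exact absurd hxy (mixed x y hx hxl hyl)
    · exact absurd hxy.symm (mixed y x hy hyl hxl)
    · have hrow : x.1.1 = y.1.1 := by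
        have := congrArg Prod.fst hxy
        simp only [φ, if_neg hxl, if_neg hyl] at this
        split_ifs at this <;> exact this
      by_cases h2 : x.1.1 < S.toLeft.card
      · have h3 : y.1.1 < S.toLeft.card := hrow ▸ h2
        simp only [φ, if_neg hxl, if_neg hyl, if_pos h2, if_pos h3] at hxy
        exact Subtype.ext hxy
      · have h3 : ¬ y.1.1 < S.toLeft.card := hrow ▸ h2
        simp only [φ, if_neg hxl, if_neg hyl, if_neg h2, if_neg h3, Prod.mk.injEq] at hxy
        rcases lt_trichotomy x.1.2 y.1.2 with h | h | h
        · exact absurd hxy.2 (countLeft_lt_countLeft hrow h hx (hright x hxl)).ne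
        · exact Subtype.ext (Prod.ext hrow h)
        · exact absurd hxy.2 (countLeft_lt_countLeft hrow.symm h hy (hright y hyl)).ne'

end IsSuperSemistandard

/-! ### The Newton polytope -/

/-- Each coefficient is a number of tableaux, so no cancellation occurs. -/
theorem mem_realSupport_superSchur {k ℓ : ℕ} {μ : YoungDiagram} {p : Fin k ⊕ Fin ℓ → ℝ} :
    p ∈ realSupport (superSchur k ℓ μ) ↔
      ∃ T : {c // c ∈ μ.cells} → Fin k ⊕ Fin ℓ, IsSuperSemistandard T ∧
        p = fun s => (letterCount T s : ℝ) := by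
  classical
  have hmono : superSchur k ℓ μ = ∑ T ∈ superSSYT k ℓ μ,
      MvPolynomial.monomial (Finsupp.equivFunOnFinite.symm (letterCount T)) (1 : ℤ) := by
    refine Finset.sum_congr rfl fun T _ => ?_
    rw [MvPolynomial.monomial_eq, Finsupp.prod_fintype _ _ (fun _ => pow_zero _),
      Fintype.prod_sum_type]
    simp
  have hcoeff : ∀ α : Fin k ⊕ Fin ℓ →₀ ℕ, MvPolynomial.coeff α (superSchur k ℓ μ) =
      ((superSSYT k ℓ μ).filter fun T =>
        Finsupp.equivFunOnFinite.symm (letterCount T) = α).card := by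
    intro α
    rw [hmono, MvPolynomial.coeff_sum]
    simp only [MvPolynomial.coeff_monomial, Finset.sum_boole]
  constructor
  · rintro ⟨α, hα, rfl⟩
    rw [hcoeff, Nat.cast_ne_zero, Finset.card_ne_zero] at hα
    obtain ⟨T, hT⟩ := hα
    rw [Finset.mem_filter, superSSYT, Finset.mem_filter] at hT
    refine ⟨T, hT.1.2, ?_⟩
    rw [← hT.2]
    rfl
  · rintro ⟨T, hT, rfl⟩
    refine ⟨Finsupp.equivFunOnFinite.symm (letterCount T), ?_, rfl⟩
    rw [hcoeff, Nat.cast_ne_zero, Finset.card_ne_zero]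
    refine ⟨T, ?_⟩
    rw [Finset.mem_filter, superSSYT, Finset.mem_filter]
    exact ⟨⟨Finset.mem_univ _, hT⟩, rfl⟩

/-- The polytope cut out by the hook inequalities. -/
def hookPolytope (k ℓ : ℕ) (μ : YoungDiagram) : Set (Fin k ⊕ Fin ℓ → ℝ) :=
  {p | (∀ s, 0 ≤ p s) ∧ ∑ s, p s = μ.card ∧
    ∀ S : Finset (Fin k ⊕ Fin ℓ),
      ∑ s ∈ S, p s ≤ (hookCells μ S.toLeft.card S.toRight.card).card}

theorem convex_hookPolytope (k ℓ : ℕ) (μ : YoungDiagram) : Convex ℝ (hookPolytope k ℓ μ) := by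
  intro p hp q hq a b ha hb hab
  have hsum : ∀ S : Finset (Fin k ⊕ Fin ℓ),
      ∑ s ∈ S, (a • p + b • q) s = a * ∑ s ∈ S, p s + b * ∑ s ∈ S, q s := by
    intro S
    simp [Finset.sum_add_distrib, Finset.mul_sum]
  refine ⟨fun s => add_nonneg (mul_nonneg ha (hp.1 s)) (mul_nonneg hb (hq.1 s)), ?_, fun S => ?_⟩
  · rw [hsum, hp.2.1, hq.2.1, ← add_mul, hab, one_mul]
  · rw [hsum]
    refine (add_le_add (mul_le_mul_of_nonneg_left (hp.2.2 S) ha)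
      (mul_le_mul_of_nonneg_left (hq.2.2 S) hb)).trans_eq ?_
    rw [← add_mul, hab, one_mul]

theorem realSupport_superSchur_subset (k ℓ : ℕ) (μ : YoungDiagram) :
    realSupport (superSchur k ℓ μ) ⊆ hookPolytope k ℓ μ := by
  intro p hp
  obtain ⟨T, hT, rfl⟩ := mem_realSupport_superSchur.1 hp
  refine ⟨fun s => Nat.cast_nonneg _, ?_, fun S => ?_⟩
  · rw [← Nat.cast_sum, sum_letterCount]
    simp
  · rw [← Nat.cast_sum, Nat.cast_le]
    exact hT.sum_letterCount_le S

theorem hookPolytope_inter_latticePoints_subset (k ℓ : ℕ) (μ : YoungDiagram) :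
    hookPolytope k ℓ μ ∩ latticePoints (Fin k ⊕ Fin ℓ) ⊆ realSupport (superSchur k ℓ μ) := by
  rintro _ ⟨⟨h0, htot, hS⟩, z, rfl⟩
  simp only [Int.cast_nonneg_iff] at h0
  lift z to Fin k ⊕ Fin ℓ → ℕ using h0
  simp only [Int.cast_natCast] at htot hS ⊢
  norm_cast at htot
  obtain ⟨T, hT, hα, hβ⟩ := exists_tableau_of_hook_inequalities (μ := μ)
    (fun i => z (Sum.inl i)) (fun j => z (Sum.inr j))
    (by rw [← htot, Fintype.sum_sum_type])
    (by
      intro I J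
      have := hS (I.disjSum J)
      rw [Finset.toLeft_disjSum, Finset.toRight_disjSum, Finset.sum_disjSum] at this
      exact_mod_cast this)
  refine mem_realSupport_superSchur.2 ⟨T, hT, ?_⟩
  funext s
  rcases s with i | j
  · rw [hα]
  · rw [hβ]

theorem mainTheorem1 (k ℓ : ℕ) (hk : 1 ≤ k) (hℓ : 1 ≤ ℓ) (μ : YoungDiagram)
    (hμ : InHook k ℓ μ) : HasSaturatedNewtonPolytope (superSchur k ℓ μ) := by
  apply Set.Subset.antisymm
  · rintro p ⟨hp, hz⟩
    exact hookPolytope_inter_latticePoints_subset k ℓ μ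
      ⟨convexHull_min (realSupport_superSchur_subset k ℓ μ) (convex_hookPolytope k ℓ μ) hp, hz⟩
  · intro p hp
    refine ⟨subset_convexHull ℝ _ hp, ?_⟩
    obtain ⟨α, -, rfl⟩ := hp
    exact ⟨fun s => (α s : ℤ), by simp⟩
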